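/- **Theorem 6.1.** There is an absolute constant $c>0$ such that the following holds for every $n\ge 0$, every $g:\{0,1\}^n\to\{0,1\}$ and the (total) function $f:\{0,1\}^n\times\{0,1\}^n\to\{0,1\}$, $f(x,y)=g(x\wedge y)$, where $\wedge$ is the bitwise conjunction. For every $z\in\{0,1\}^n$ with $\hat g_z\neq 0$, $$BQC(f)\;\ge\; c\cdot\frac{|z|}{1-\log_2|\hat g_z|}.$$ (For $\hat g_z=0$ the bound is read as $0$ and says nothing.) Here $|z|$ is the number of ones of $z$ and $\hat g_z=2^{-n}\sum_{x\in\{0,1\}^n} g(x)\,(-1)^{\sum_i x_iz_i}$. $BQC(f)$ is the bounded error two-party quantum communication complexity of $f$: the least number of qubits exchanged in a quantum protocol that outputs $f(x,y)$ with probability at least $2/3$ on every input $(x,y)$. In a protocol each player has a private set of qubits; $n$ of Alice's qubits are initialized to $x$ and $n$ of Bob's to $y$, and finitely many further qubits of each player to $|0\rangle$ (there is no shared entanglement). In a communication round one of the players applies a unitary transformation to the qubits in his possession and then hands one of his qubits to the other player; the unitaries and the qubits sent are fixed in advance, independently of the inputs. At the end one qubit is measured in the computational basis and the result is the output. -/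

import Mathlib

open scoped ENNReal

noncomputable section

/-! ### Fourier coefficients on the Boolean cube `{0,1}^n = Fin n → Bool` -/

/-- The inner product `⟨F, G⟩ = 2^{-n} ∑_x F(x) G(x)` on functions `{0,1}^n → ℝ`. -/
def cubeInner {n : ℕ} (F G : (Fin n → Bool) → ℝ) : ℝ :=
  (1 / 2 ^ n) * ∑ x : Fin n → Bool, F x * G x

/-- The bitwise conjunction `x ∧ y` of two bit strings. -/
def bitAnd {n : ℕ} (x y : Fin n → Bool) : Fin n → Bool := fun i => x i && y i

/-- The Hamming weight `|z|`: the number of ones of `z`. -/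
def hammingWeight {n : ℕ} (z : Fin n → Bool) : ℕ :=
  (Finset.univ.filter fun i => z i = true).card

/-- The character `χ_z(x) = (-1)^{∑ᵢ xᵢ zᵢ}`. -/
def character {n : ℕ} (z x : Fin n → Bool) : ℝ := (-1) ^ hammingWeight (bitAnd x z)

/-- The `0/1`-valued real function given by a Boolean function. -/
def toReal01 {n : ℕ} (g : (Fin n → Bool) → Bool) : (Fin n → Bool) → ℝ :=
  fun x => if g x = true then 1 else 0

/-- The Fourier coefficient `ĝ_z = ⟨g, χ_z⟩` of `g : {0,1}^n → {0,1}`. -/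
def fourierCoeff01 {n : ℕ} (g : (Fin n → Bool) → Bool) (z : Fin n → Bool) : ℝ :=
  cubeInner (toReal01 g) (character z)

/-! ### Two-party quantum communication protocols -/

/-- The two players. -/
inductive Player where
  | alice : Player
  | bob : Player
  deriving DecidableEq

/-- The opponent of a player. -/
def Player.other : Player → Player
  | .alice => .bob
  | .bob => .alice

/-- A pure state of the qubits in `Q`: an amplitude for each basis state `|s⟩`, `s : Q → {0,1}`. -/
abbrev QState (Q : Type) : Type := (Q → Bool) → ℂ

/-- The basis state `|s⟩`. -/
def basisState {Q : Type} [Fintype Q] [DecidableEq Q] (s : Q → Bool) : QState Q :=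
  fun t => if t = s then 1 else 0

/-- The action of `U ⊗ I` on a state of the qubits in `Q`, where `U` is a matrix acting on the
qubits satisfying `P` and `I` is the identity on the remaining qubits. -/
def applyLocal {Q : Type} [Fintype Q] [DecidableEq Q] (P : Q → Prop) [DecidablePred P]
    (U : Matrix ({q : Q // P q} → Bool) ({q : Q // P q} → Bool) ℂ) (ψ : QState Q) : QState Q :=
  fun s => ∑ t : {q : Q // P q} → Bool,
    U (fun q => s q.1) t * ψ (fun q => if h : P q then t ⟨q, h⟩ else s q)

/-- The part of a protocol that remains to be executed when the qubits in `Q` are currently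
distributed among the players according to `own`.  Either the protocol is over and a qubit is
measured, or there is a communication round: a player `p` applies a unitary transformation to
the qubits in his possession and then hands one of his qubits over to the other player.  All
these choices are fixed in advance, independently of the inputs. -/
inductive QProtocol (Q : Type) [Fintype Q] [DecidableEq Q] : (Q → Player) → Type where
  | measure {own : Q → Player} (q : Q) : QProtocol Q own
  | round {own : Q → Player} (p : Player)
      (U : Matrix.unitaryGroup ({q : Q // own q = p} → Bool) ℂ)
      (q : Q) (hq : own q = p)
      (rest : QProtocol Q (Function.update own q p.other)) : QProtocol Q own

namespace QProtocol

variable {Q : Type} [Fintype Q] [DecidableEq Q]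

/-- The communication: the number of qubits exchanged. -/
def cost : {own : Q → Player} → QProtocol Q own → ℕ
  | _, measure _ => 0
  | _, round _ _ _ _ rest => rest.cost + 1

/-- The global state right before the final measurement, from the current global state.  Sending
a qubit changes only its owner. -/
def finalState : {own : Q → Player} → QProtocol Q own → QState Q → QState Q
  | _, measure _, ψ => ψ
  | own, round p U _ _ rest, ψ => rest.finalState (applyLocal (fun q => own q = p) U.1 ψ)

/-- The qubit measured at the end. -/
def outputQubit : {own : Q → Player} → QProtocol Q own → Q
  | _, measure q => q
  | _, round _ _ _ _ rest => rest.outputQubit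

/-- The probability that the final measurement, in the computational basis, yields the bit `b`,
when the protocol is started in the state `ψ`. -/
def outputProb {own : Q → Player} (π : QProtocol Q own) (ψ : QState Q) (b : Bool) : ℝ :=
  ∑ s : Q → Bool, if s π.outputQubit = b then ‖π.finalState ψ s‖ ^ 2 else 0

end QProtocol

/-- The qubits of a protocol on inputs from `{0,1}^n × {0,1}^n`: Alice (left summand) has `n`
qubits for her input and `a` work qubits, Bob has `n` qubits for his input and `b` work qubits. -/
abbrev Qubits (n a b : ℕ) : Type := (Fin n ⊕ Fin a) ⊕ (Fin n ⊕ Fin b)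

/-- The distribution of the qubits at the start of the protocol. -/
def initialOwner (n a b : ℕ) : Qubits n a b → Player :=
  Sum.elim (fun _ => Player.alice) (fun _ => Player.bob)

/-- The state `|x⟩|0^a⟩|y⟩|0^b⟩` at the start of the protocol. -/
def initialState {n : ℕ} (a b : ℕ) (x y : Fin n → Bool) : QState (Qubits n a b) :=
  basisState (Sum.elim (Sum.elim x fun _ => false) (Sum.elim y fun _ => false))

/-- The protocol `π` computes `f` with error at most `ε`: on every input the output is correct
with probability at least `1 - ε`. -/
def ComputesWithError {n a b : ℕ} (π : QProtocol (Qubits n a b) (initialOwner n a b))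
    (f : (Fin n → Bool) → (Fin n → Bool) → Bool) (ε : ℝ) : Prop :=
  ∀ x y, 1 - ε ≤ π.outputProb (initialState a b x y) (f x y)

/-- `BQC_ε(f)`: the least communication of a quantum protocol, with any number of work qubits,
that computes `f` with error at most `ε`. -/
def BQCError {n : ℕ} (ε : ℝ) (f : (Fin n → Bool) → (Fin n → Bool) → Bool) : ℕ∞ :=
  ⨅ (a : ℕ) (b : ℕ) (π : QProtocol (Qubits n a b) (initialOwner n a b))
    (_ : ComputesWithError π f ε), (π.cost : ℕ∞)

/-- `BQC(f) = BQC_{1/3}(f)`, the bounded error quantum communication complexity of `f`. -/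
def BQC {n : ℕ} (f : (Fin n → Bool) → (Fin n → Bool) → Bool) : ℕ∞ := BQCError (1 / 3) f

end

/-! A protocol exchanging `c` qubits has an output-probability matrix in `(x, y)` that factors
through short vectors, while `g(x ∧ y)` can be tested against a signed measure that correlates
weakly with every such matrix. Comparing the two bounds `ĝ_z`.

Upper side: the global state is a sum of products of vectors of Alice and of Bob. Local unitaries
preserve their total squared norm and each transferred qubit at most doubles the bound
(`IsSplit.transfer`), so squaring amplitudes gives a factorization with constant `4 ^ c`
(`QProtocol.hasFactorization_outputProb`). Factorizations are closed under entrywise sums and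
products, so the error can be reduced by applying a majority polynomial to the matrix of
probabilities; no repeated protocol has to be built. With `2m` trials the constant is `(4 * 16 ^ c)
^ m` and the error `(8/9) ^ m`.

Lower side: draw each pair of bits from `andDist`, so that `x ∧ y` is uniform and `ĝ_z` is the
expectation of `g(x ∧ y)` times a product of signs. At each coordinate with `z i = 1` the signed
form has norm below `17/20` relative to the marginals, and norms multiply over coordinates, so a
matrix with constant `K` has correlation at most `(17/20) ^ |z| * K`
(`norm_sum_mul_le_of_hasFactorization`).

Hence `|ĝ_z| ≤ (17/20) ^ |z| * (4 * 16 ^ c) ^ m + (8/9) ^ m`. Taking `m` proportional to `1 - log₂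
|ĝ_z|` makes the last term at most half of the left side, and solving for `|z|` gives the bound. -/

/-! ### Calculus of factorizations through short vectors. -/

/-- `M` factors as `M x y = ∑ i, u i x * v i y` through vectors `u · x`, `v · y` of squared
Euclidean norm at most `K`. -/
def HasFactorization {X Y : Type} (K : ℝ) (M : X → Y → ℂ) : Prop :=
  ∃ (I : Type) (_ : Fintype I) (u : I → X → ℂ) (v : I → Y → ℂ),
    (∀ x y, M x y = ∑ i, u i x * v i y) ∧
    (∀ x, ∑ i, ‖u i x‖ ^ 2 ≤ K) ∧ ∀ y, ∑ i, ‖v i y‖ ^ 2 ≤ K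

namespace HasFactorization

variable {X Y : Type} {K K' : ℝ} {M M' : X → Y → ℂ}

theorem one : HasFactorization 1 (fun (_ : X) (_ : Y) => (1 : ℂ)) :=
  ⟨Unit, inferInstance, fun _ _ => 1, fun _ _ => 1, by simp, by simp, by simp⟩

theorem zero : HasFactorization 0 (fun (_ : X) (_ : Y) => (0 : ℂ)) :=
  ⟨Empty, inferInstance, fun _ _ => 1, fun _ _ => 1, by simp, by simp, by simp⟩

theorem add (h : HasFactorization K M) (h' : HasFactorization K' M') :
    HasFactorization (K + K') (fun x y => M x y + M' x y) := by
  obtain ⟨I, _, u, v, hM, hu, hv⟩ := h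
  obtain ⟨J, _, u', v', hM', hu', hv'⟩ := h'
  refine ⟨I ⊕ J, inferInstance, Sum.elim u u', Sum.elim v v', ?_, ?_, ?_⟩
  · intro x y; simp [hM, hM']
  · intro x; simpa using add_le_add (hu x) (hu' x)
  · intro y; simpa using add_le_add (hv y) (hv' y)

/-- Tensoring the two families of vectors multiplies both inner products and squared norms. -/
theorem mul (h : HasFactorization K M) (h' : HasFactorization K' M') (hK : 0 ≤ K) :
    HasFactorization (K * K') (fun x y => M x y * M' x y) := by
  obtain ⟨I, _, u, v, hM, hu, hv⟩ := h
  obtain ⟨J, _, u', v', hM', hu', hv'⟩ := h'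
  refine ⟨I × J, inferInstance, fun i x => u i.1 x * u' i.2 x, fun i y => v i.1 y * v' i.2 y,
    ?_, ?_, ?_⟩
  · intro x y
    simp only [hM, hM', Finset.sum_mul_sum, Fintype.sum_prod_type]
    exact Finset.sum_congr rfl fun i _ => Finset.sum_congr rfl fun j _ => by ring
  · intro x
    simp only [norm_mul, mul_pow, Fintype.sum_prod_type, ← Finset.sum_mul_sum]
    exact mul_le_mul (hu x) (hu' x) (by positivity) hK
  · intro y
    simp only [norm_mul, mul_pow, Fintype.sum_prod_type, ← Finset.sum_mul_sum]
    exact mul_le_mul (hv y) (hv' y) (by positivity) hK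

theorem pow (h : HasFactorization K M) (hK : 0 ≤ K) (d : ℕ) :
    HasFactorization (K ^ d) (fun x y => M x y ^ d) := by
  induction d with
  | zero => simpa using one
  | succ d ih => simpa only [pow_succ] using ih.mul h (by positivity)

theorem const_mul (h : HasFactorization K M) {c : ℝ} (hc : 0 ≤ c) :
    HasFactorization (c * K) (fun x y => (c : ℂ) * M x y) := by
  obtain ⟨I, _, u, v, hM, hu, hv⟩ := h
  have hs : ((Real.sqrt c : ℝ) : ℂ) * (Real.sqrt c : ℝ) = c := by
    rw [← Complex.ofReal_mul, Real.mul_self_sqrt hc]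
  have hn : ‖((Real.sqrt c : ℝ) : ℂ)‖ ^ 2 = c := by
    rw [Complex.norm_real, Real.norm_eq_abs, sq_abs, Real.sq_sqrt hc]
  refine ⟨I, inferInstance, fun i x => (Real.sqrt c : ℝ) * u i x,
    fun i y => (Real.sqrt c : ℝ) * v i y, ?_, ?_, ?_⟩
  · intro x y
    simp only [hM, Finset.mul_sum]
    refine Finset.sum_congr rfl fun i _ => ?_
    rw [← hs]; ring
  · intro x
    simp only [norm_mul, mul_pow, hn, ← Finset.mul_sum]
    exact mul_le_mul_of_nonneg_left (hu x) hc
  · intro y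
    simp only [norm_mul, mul_pow, hn, ← Finset.mul_sum]
    exact mul_le_mul_of_nonneg_left (hv y) hc

theorem sum {ι : Type} (s : Finset ι) {K : ι → ℝ} {M : ι → X → Y → ℂ}
    (h : ∀ i ∈ s, HasFactorization (K i) (M i)) :
    HasFactorization (∑ i ∈ s, K i) (fun x y => ∑ i ∈ s, M i x y) := by
  classical
  induction s using Finset.induction_on with
  | empty => simpa using zero
  | insert a s ha ih =>
    simp only [Finset.sum_insert ha]
    exact (h a (by simp)).add (ih fun i hi => h i (by simp [hi]))

end HasFactorization

/-! ### Amplification by majority -/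

/-- The probability that at least half of `2 * m` independent trials succeed, as a polynomial in
the probabilities `p` and `q` of success and failure. -/
def majorityPoly {R : Type} [CommSemiring R] (m : ℕ) (p q : R) : R :=
  ∑ i ∈ Finset.Icc m (2 * m), ((2 * m).choose i : R) * (p ^ i * q ^ (2 * m - i))

/-- Every monomial has total degree `2m`, hence constant `K ^ (2m)`, and the binomial coefficients
sum to at most `4 ^ m`. -/
theorem HasFactorization.majorityPoly {X Y : Type} {K : ℝ} {M M' : X → Y → ℂ}
    (h : HasFactorization K M) (h' : HasFactorization K M') (hK : 0 ≤ K) (m : ℕ) :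
    HasFactorization ((4 * K ^ 2) ^ m) (fun x y => majorityPoly m (M x y) (M' x y)) := by
  have key : HasFactorization
      (∑ i ∈ Finset.Icc m (2 * m), ((2 * m).choose i : ℝ) * (K ^ i * K ^ (2 * m - i)))
      (fun x y => _root_.majorityPoly m (M x y) (M' x y)) := by
    refine HasFactorization.sum _ fun i _ => ?_
    have := ((h.pow hK i).mul (h'.pow hK (2 * m - i)) (by positivity)).const_mul
      (c := ((2 * m).choose i : ℝ)) (by positivity)
    simpa using this
  have hle : ∑ i ∈ Finset.Icc m (2 * m), ((2 * m).choose i : ℝ) * (K ^ i * K ^ (2 * m - i))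
      ≤ (4 * K ^ 2) ^ m := by
    have h1 : ∀ i ∈ Finset.Icc m (2 * m),
        ((2 * m).choose i : ℝ) * (K ^ i * K ^ (2 * m - i)) = ((2 * m).choose i : ℝ) * K ^ (2 * m) := by
      intro i hi
      rw [← pow_add, Nat.add_sub_cancel' (Finset.mem_Icc.1 hi).2]
    rw [Finset.sum_congr rfl h1, ← Finset.sum_mul, mul_pow, ← pow_mul]
    refine mul_le_mul_of_nonneg_right ?_ (by positivity)
    have h2 : ∑ i ∈ Finset.range (2 * m + 1), ((2 * m).choose i : ℝ) = 4 ^ m := by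
      have := Nat.sum_range_choose (2 * m)
      rw [pow_mul] at this
      exact_mod_cast this
    rw [← h2]
    refine Finset.sum_le_sum_of_subset_of_nonneg ?_ fun i _ _ => by positivity
    intro i hi
    simp only [Finset.mem_Icc, Finset.mem_range] at hi ⊢
    omega
  obtain ⟨I, hI, u, v, hM, hu, hv⟩ := key
  exact ⟨I, hI, u, v, hM, fun x => (hu x).trans hle, fun y => (hv y).trans hle⟩

/-- An elementary tail bound: when each monomial is dominated by the balanced one, which is at most
`(2/9) ^ m`, the total is at most `4 ^ m * (2/9) ^ m`. -/
theorem sum_choose_mul_le (m : ℕ) {p q : ℝ} (hp : 0 ≤ p) (hq : 0 ≤ q) (hpq : p * q ≤ 2 / 9)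
    (s : Finset ℕ) (hs : s ⊆ Finset.range (2 * m + 1))
    (h : ∀ i ∈ s, p ^ i * q ^ (2 * m - i) ≤ (p * q) ^ m) :
    ∑ i ∈ s, ((2 * m).choose i : ℝ) * (p ^ i * q ^ (2 * m - i)) ≤ (8 / 9) ^ m := by
  have h2 : ∑ i ∈ Finset.range (2 * m + 1), ((2 * m).choose i : ℝ) = 4 ^ m := by
    have := Nat.sum_range_choose (2 * m)
    rw [pow_mul] at this
    exact_mod_cast this
  calc ∑ i ∈ s, ((2 * m).choose i : ℝ) * (p ^ i * q ^ (2 * m - i))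
      ≤ ∑ i ∈ s, ((2 * m).choose i : ℝ) * (2 / 9) ^ m := by
        refine Finset.sum_le_sum fun i hi => mul_le_mul_of_nonneg_left ?_ (by positivity)
        exact (h i hi).trans (pow_le_pow_left₀ (by positivity) hpq m)
    _ ≤ ∑ i ∈ Finset.range (2 * m + 1), ((2 * m).choose i : ℝ) * (2 / 9) ^ m :=
        Finset.sum_le_sum_of_subset_of_nonneg hs fun i _ _ => by positivity
    _ = (8 / 9) ^ m := by
        rw [← Finset.sum_mul, h2, ← mul_pow]; norm_num

theorem pow_mul_pow_le_of_le {m i j : ℕ} (hij : i + j = 2 * m) (hi : m ≤ i) {p q : ℝ}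
    (hp : 0 ≤ p) (hpq : p ≤ q) : p ^ i * q ^ j ≤ (p * q) ^ m := by
  obtain ⟨k, rfl⟩ := Nat.exists_eq_add_of_le hi
  obtain rfl : m = j + k := by omega
  calc p ^ (j + k + k) * q ^ j = p ^ (j + k) * q ^ j * p ^ k := by ring
    _ ≤ p ^ (j + k) * q ^ j * q ^ k := by
      have := pow_le_pow_left₀ hp hpq k
      have hq := hp.trans hpq
      gcongr
    _ = _ := by ring

theorem majorityPoly_nonneg (m : ℕ) {p q : ℝ} (hp : 0 ≤ p) (hq : 0 ≤ q) :
    0 ≤ majorityPoly m p q := Finset.sum_nonneg fun i _ => by positivity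

theorem majorityPoly_le_of_le_third (m : ℕ) {p q : ℝ} (hp : 0 ≤ p) (hpq : p + q = 1)
    (h : p ≤ 1 / 3) : majorityPoly m p q ≤ (8 / 9) ^ m := by
  refine sum_choose_mul_le m hp (by linarith) (by nlinarith) _ ?_ ?_
  · intro i hi
    simp only [Finset.mem_Icc, Finset.mem_range] at hi ⊢
    omega
  · intro i hi
    rw [Finset.mem_Icc] at hi
    exact pow_mul_pow_le_of_le (by omega) hi.1 hp (by linarith)

theorem one_sub_majorityPoly_mem (m : ℕ) {p q : ℝ} (hq : 0 ≤ q) (hpq : p + q = 1)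
    (h : q ≤ 1 / 3) : 0 ≤ 1 - majorityPoly m p q ∧ 1 - majorityPoly m p q ≤ (8 / 9) ^ m := by
  have hsum : 1 - majorityPoly m p q =
      ∑ i ∈ Finset.range m, ((2 * m).choose i : ℝ) * (p ^ i * q ^ (2 * m - i)) := by
    -- The complement of the majority event is the lower part of the expansion of `(p + q) ^ (2m) =
    -- 1`.
    have h1 := add_pow p q (2 * m)
    rw [hpq, one_pow, ← Finset.sum_range_add_sum_Ico _ (show m ≤ 2 * m + 1 by omega)] at h1
    have h2 : Finset.Ico m (2 * m + 1) = Finset.Icc m (2 * m) := by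
      ext i; simp only [Finset.mem_Ico, Finset.mem_Icc]; omega
    rw [h2] at h1
    rw [sub_eq_iff_eq_add, h1, majorityPoly]
    congr 1 <;> exact Finset.sum_congr rfl fun i _ => by ring
  have hp : 0 ≤ p := by linarith
  rw [hsum]
  refine ⟨Finset.sum_nonneg fun i _ => by positivity,
    sum_choose_mul_le m hp hq (by nlinarith) _ ?_ ?_⟩
  · intro i hi
    simp only [Finset.mem_range] at hi ⊢
    omega
  · intro i hi
    rw [Finset.mem_range] at hi
    rw [mul_comm, mul_comm p q]
    exact pow_mul_pow_le_of_le (by omega) (by omega) hq (by linarith)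

/-! ### The inner product function has small correlation with factorizations -/

theorem sum_cons {n : ℕ} {A : Type} [AddCommMonoid A] (F : (Fin (n + 1) → Bool) → A) :
    ∑ x, F x = ∑ s : Bool, ∑ x : Fin n → Bool, F (Fin.cons s x) := by
  rw [← Fintype.sum_prod_type']
  exact (Equiv.sum_comp (Fin.consEquiv fun _ => Bool) F).symm

/-- Operator norms on weighted `ℓ²` are multiplicative under tensor products: the induction
hypothesis treats the tail for each value of the first input bit, and the one-bit bound then treats
the head pointwise in the tail. -/
theorem sum_norm_sq_tensor_le (p : Bool → ℝ) (hp : ∀ s, 0 ≤ p s) {n : ℕ}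
    (k : Fin n → Bool → Bool → ℝ) (θ : Fin n → ℝ) (hθ : ∀ i, 0 ≤ θ i)
    (hk : ∀ i (a : Bool → ℂ),
      ∑ t, p t * ‖∑ s, (k i s t : ℂ) * a s‖ ^ 2 ≤ θ i * ∑ s, p s * ‖a s‖ ^ 2)
    (u : (Fin n → Bool) → ℂ) :
    ∑ y : Fin n → Bool, (∏ i, p (y i)) * ‖∑ x : Fin n → Bool,
        ((∏ i, k i (x i) (y i) : ℝ) : ℂ) * u x‖ ^ 2 ≤
      (∏ i, θ i) * ∑ x : Fin n → Bool, (∏ i, p (x i)) * ‖u x‖ ^ 2 := by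
  induction n with
  | zero => simp
  | succ n ih =>
    set a : Bool → (Fin n → Bool) → ℂ := fun s y => ∑ x : Fin n → Bool,
      ((∏ i, k i.succ (x i) (y i) : ℝ) : ℂ) * u (Fin.cons s x) with ha
    have hP : ∀ y : Fin n → Bool, 0 ≤ ∏ i, p (y i) := fun y => Finset.prod_nonneg fun i _ => hp _
    have h1 : ∀ s, ∑ y : Fin n → Bool, (∏ i, p (y i)) * ‖a s y‖ ^ 2 ≤
        (∏ i : Fin n, θ i.succ) * ∑ x : Fin n → Bool, (∏ i, p (x i)) * ‖u (Fin.cons s x)‖ ^ 2 :=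
      fun s => ih (fun i => k i.succ) (fun i => θ i.succ) (fun i => hθ _) (fun i => hk _)
        (fun x => u (Fin.cons s x))
    have h2 : ∀ (t : Bool) (y : Fin n → Bool), ∑ x : Fin (n + 1) → Bool,
        ((∏ i, k i (x i) ((Fin.cons t y : Fin (n + 1) → Bool) i) : ℝ) : ℂ) * u x =
        ∑ s, (k 0 s t : ℂ) * a s y := by
      intro t y
      rw [sum_cons]
      refine Finset.sum_congr rfl fun s _ => ?_
      rw [ha, Finset.mul_sum]
      refine Finset.sum_congr rfl fun x _ => ?_
      rw [Fin.prod_univ_succ]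
      simp only [Fin.cons_zero, Fin.cons_succ, Complex.ofReal_mul]
      ring
    rw [sum_cons, sum_cons]
    simp only [h2]
    simp only [Fin.prod_univ_succ, Fin.cons_zero, Fin.cons_succ]
    calc ∑ t, ∑ y : Fin n → Bool, p t * (∏ i, p (y i)) * ‖∑ s, (k 0 s t : ℂ) * a s y‖ ^ 2
        = ∑ y : Fin n → Bool, (∏ i, p (y i)) * ∑ t, p t * ‖∑ s, (k 0 s t : ℂ) * a s y‖ ^ 2 := by
          rw [Finset.sum_comm]
          refine Finset.sum_congr rfl fun y _ => ?_
          rw [Finset.mul_sum]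
          exact Finset.sum_congr rfl fun t _ => by ring
      _ ≤ ∑ y : Fin n → Bool, (∏ i, p (y i)) * (θ 0 * ∑ s, p s * ‖a s y‖ ^ 2) :=
          Finset.sum_le_sum fun y _ => mul_le_mul_of_nonneg_left (hk 0 _) (hP y)
      _ = θ 0 * ∑ s, p s * ∑ y : Fin n → Bool, (∏ i, p (y i)) * ‖a s y‖ ^ 2 := by
          simp only [Finset.mul_sum]
          rw [Finset.sum_comm]
          exact Finset.sum_congr rfl fun s _ => Finset.sum_congr rfl fun y _ => by ring
      _ ≤ θ 0 * ∑ s, p s * ((∏ i : Fin n, θ i.succ) *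
            ∑ x : Fin n → Bool, (∏ i, p (x i)) * ‖u (Fin.cons s x)‖ ^ 2) :=
          mul_le_mul_of_nonneg_left
            (Finset.sum_le_sum fun s _ => mul_le_mul_of_nonneg_left (h1 s) (hp s)) (hθ 0)
      _ = _ := by
          simp only [Finset.mul_sum]
          exact Finset.sum_congr rfl fun s _ => Finset.sum_congr rfl fun x _ => by ring

/-- The weights `1/3, 2/3` of the marginals of `andDist`. -/
noncomputable def bitWeight (s : Bool) : ℝ := if s then 2 / 3 else 1 / 3

/-- A distribution of a pair of bits whose conjunction is uniform. -/
noncomputable def andDist (s t : Bool) : ℝ := if s && t then 1 / 2 else 1 / 6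

/-- The sign `(-1)^{b s t}`. -/
noncomputable def andSign (b s t : Bool) : ℝ := if (s && t) && b then -1 else 1

theorem bitWeight_pos (s : Bool) : 0 < bitWeight s := by
  cases s <;> norm_num [bitWeight]

/-- The one-bit norm. Without the sign the kernel is an averaging operator, of norm `1`; with the
sign the exact norm is `(1 + √33) / 8 ≈ 0.843`, rounded up to `17/20`. The kernel is real, so real
and imaginary parts can be treated separately. -/
theorem sum_bitWeight_norm_sq_le (b : Bool) (a : Bool → ℂ) :
    ∑ t, bitWeight t * ‖∑ s, ((andDist s t * andSign b s t / bitWeight t : ℝ) : ℂ) * a s‖ ^ 2 ≤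
      (if b then (17 / 20) ^ 2 else 1) * ∑ s, bitWeight s * ‖a s‖ ^ 2 := by
  have key : ∀ v w : ℝ,
      1 / 3 * (1 / 2 * w + 1 / 2 * v) ^ 2 + 2 / 3 * (1 / 4 * v - 3 / 4 * w) ^ 2 ≤
        (17 / 20) ^ 2 * (1 / 3 * v ^ 2 + 2 / 3 * w ^ 2) ∧
      1 / 3 * (1 / 2 * w + 1 / 2 * v) ^ 2 + 2 / 3 * (1 / 4 * v + 3 / 4 * w) ^ 2 ≤
        1 / 3 * v ^ 2 + 2 / 3 * w ^ 2 := by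
    intro v w
    refine ⟨?_, ?_⟩
    · nlinarith [sq_nonneg (v + 4 / 10 * w), sq_nonneg w, sq_nonneg v]
    · nlinarith [sq_nonneg (v - w)]
  have hre := key (a false).re (a true).re
  have him := key (a false).im (a true).im
  simp only [Fintype.sum_bool, Complex.sq_norm, Complex.normSq_apply]
  cases b <;> simp [bitWeight, andDist, andSign] <;> norm_num <;> nlinarith

theorem norm_sum_mul_le_of_hasFactorization {n : ℕ} (z : Fin n → Bool) {K : ℝ}
    {M : (Fin n → Bool) → (Fin n → Bool) → ℂ} (hM : HasFactorization K M) :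
    ‖∑ x, ∑ y, ((∏ i, andDist (x i) (y i) * andSign (z i) (x i) (y i) : ℝ) : ℂ) * M x y‖ ≤
      (17 / 20) ^ hammingWeight z * K := by
  obtain ⟨I, _, u, v, hM, hu, hv⟩ := hM
  set P : (Fin n → Bool) → ℝ := fun y => ∏ i, bitWeight (y i) with hPdef
  have hP : ∀ y, 0 < P y := fun y => Finset.prod_pos fun i _ => bitWeight_pos _
  have hP1 : ∑ y, P y = 1 := by
    have := Finset.prod_univ_sum (fun _ : Fin n => (Finset.univ : Finset Bool))
      (fun _ s => bitWeight s)
    rw [Fintype.piFinset_univ] at this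
    rw [hPdef, ← this]
    norm_num [bitWeight]
  -- Dividing by the marginal of `t` turns the bilinear form into an operator on `ℓ²` with weights
  -- `bitWeight`.
  set k : Fin n → Bool → Bool → ℝ :=
    fun i s t => andDist s t * andSign (z i) s t / bitWeight t with hk
  set T : I → (Fin n → Bool) → ℂ := fun j y => ∑ x, ((∏ i, k i (x i) (y i) : ℝ) : ℂ) * u j x
    with hT
  set θ : ℝ := (17 / 20) ^ hammingWeight z with hθ
  have hθ0 : 0 < θ := by positivity
  have hprod : ∏ i, (if z i then ((17 : ℝ) / 20) ^ 2 else 1) = θ ^ 2 := by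
    rw [Finset.prod_ite, Finset.prod_const, Finset.prod_const_one, mul_one, hθ, ← pow_mul,
      ← pow_mul, mul_comm]
    rfl
  have hTn : ∀ j, ∑ y, P y * ‖T j y‖ ^ 2 ≤ θ ^ 2 * ∑ x, P x * ‖u j x‖ ^ 2 := by
    intro j
    rw [← hprod]
    refine sum_norm_sq_tensor_le bitWeight (fun s => (bitWeight_pos s).le) k _ ?_ ?_ (u j)
    · intro i; split_ifs <;> positivity
    · exact fun i a => sum_bitWeight_norm_sq_le (z i) a
  have havg : ∀ w : I → (Fin n → Bool) → ℂ, (∀ x, ∑ j, ‖w j x‖ ^ 2 ≤ K) →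
      ∑ j, ∑ x, P x * ‖w j x‖ ^ 2 ≤ K := by
    intro w hw
    rw [Finset.sum_comm]
    calc ∑ x, ∑ j, P x * ‖w j x‖ ^ 2 ≤ ∑ x, P x * K := by
          refine Finset.sum_le_sum fun x _ => ?_
          rw [← Finset.mul_sum]
          exact mul_le_mul_of_nonneg_left (hw x) (hP x).le
      _ = K := by rw [← Finset.sum_mul, hP1, one_mul]
  have hform : ∑ x, ∑ y, ((∏ i, andDist (x i) (y i) * andSign (z i) (x i) (y i) : ℝ) : ℂ) * M x y
      = ∑ j, ∑ y, (P y : ℂ) * (T j y * v j y) := by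
    have hW : ∀ x y : Fin n → Bool, (∏ i, andDist (x i) (y i) * andSign (z i) (x i) (y i)) =
        P y * ∏ i, k i (x i) (y i) := by
      intro x y
      rw [hPdef, ← Finset.prod_mul_distrib]
      refine Finset.prod_congr rfl fun i _ => ?_
      rw [hk, mul_div_cancel₀ _ (bitWeight_pos _).ne']
    calc _ = ∑ x, ∑ y, ∑ j, (P y : ℂ) * (((∏ i, k i (x i) (y i) : ℝ) : ℂ) * u j x * v j y) := by
          refine Finset.sum_congr rfl fun x _ => Finset.sum_congr rfl fun y _ => ?_
          rw [hW, hM, Finset.mul_sum]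
          refine Finset.sum_congr rfl fun j _ => ?_
          rw [Complex.ofReal_mul]; ring
      _ = ∑ y, ∑ j, ∑ x, (P y : ℂ) * (((∏ i, k i (x i) (y i) : ℝ) : ℂ) * u j x * v j y) := by
          rw [Finset.sum_comm]
          exact Finset.sum_congr rfl fun y _ => Finset.sum_comm
      _ = _ := by
          rw [Finset.sum_comm]
          refine Finset.sum_congr rfl fun j _ => Finset.sum_congr rfl fun y _ => ?_
          rw [hT, Finset.sum_mul, Finset.mul_sum]
  rw [hform]
  calc ‖∑ j, ∑ y, (P y : ℂ) * (T j y * v j y)‖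
      ≤ ∑ j, ∑ y, P y * (‖T j y‖ * ‖v j y‖) := by
        refine (norm_sum_le _ _).trans (Finset.sum_le_sum fun j _ => (norm_sum_le _ _).trans
          (Finset.sum_le_sum fun y _ => ?_))
        rw [norm_mul, norm_mul, Complex.norm_real, Real.norm_of_nonneg (hP y).le]
    -- Cauchy–Schwarz in the form of a weighted AM–GM; the weight `1 / θ` balances the two sums,
    -- since the vectors `T` have gained a factor `θ ^ 2` in squared norm.
    _ ≤ ∑ j, ∑ y, (1 / (2 * θ) * (P y * ‖T j y‖ ^ 2) + θ / 2 * (P y * ‖v j y‖ ^ 2)) := by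
        refine Finset.sum_le_sum fun j _ => Finset.sum_le_sum fun y _ => ?_
        have h1 : ‖T j y‖ * ‖v j y‖ ≤ 1 / (2 * θ) * ‖T j y‖ ^ 2 + θ / 2 * ‖v j y‖ ^ 2 := by
          have : 1 / (2 * θ) * ‖T j y‖ ^ 2 + θ / 2 * ‖v j y‖ ^ 2 - ‖T j y‖ * ‖v j y‖ =
              1 / (2 * θ) * (‖T j y‖ - θ * ‖v j y‖) ^ 2 := by field_simp; ring
          have h0 : 0 ≤ 1 / (2 * θ) * (‖T j y‖ - θ * ‖v j y‖) ^ 2 := by positivity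
          linarith
        calc _ ≤ P y * (1 / (2 * θ) * ‖T j y‖ ^ 2 + θ / 2 * ‖v j y‖ ^ 2) :=
              mul_le_mul_of_nonneg_left h1 (hP y).le
          _ = _ := by ring
    _ = 1 / (2 * θ) * ∑ j, ∑ y, P y * ‖T j y‖ ^ 2 + θ / 2 * ∑ j, ∑ y, P y * ‖v j y‖ ^ 2 := by
        simp only [Finset.sum_add_distrib, Finset.mul_sum]
    _ ≤ 1 / (2 * θ) * (θ ^ 2 * K) + θ / 2 * K := by
        have h1 : ∑ j, ∑ y, P y * ‖T j y‖ ^ 2 ≤ θ ^ 2 * K := by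
          refine (Finset.sum_le_sum fun j _ => hTn j).trans ?_
          rw [← Finset.mul_sum]
          exact mul_le_mul_of_nonneg_left (havg u hu) (by positivity)
        have h2 := havg v hv
        gcongr
    _ = θ * K := by field_simp; ring

/-! ### Fourier coefficients as correlations -/

theorem character_bitAnd {n : ℕ} (z x y : Fin n → Bool) :
    character z (bitAnd x y) = ∏ i, andSign (z i) (x i) (y i) := by
  simp only [andSign]
  rw [Finset.prod_ite, Finset.prod_const, Finset.prod_const_one, mul_one]
  rfl

/-- Under `andDist` a conjunction is `1` with probability `1/2` and `0` with probability `3 * (1/6)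
= 1/2`, independently over the coordinates. -/
theorem sum_andDist_bitAnd {n : ℕ} (h : (Fin n → Bool) → ℝ) :
    ∑ x, ∑ y, (∏ i, andDist (x i) (y i)) * h (bitAnd x y) = (1 / 2 ^ n) * ∑ w, h w := by
  have hpi : ∀ F : Fin n → Bool → ℝ, ∑ x : Fin n → Bool, ∏ i, F i (x i) = ∏ i, ∑ s, F i s := by
    intro F
    rw [Finset.prod_univ_sum, Fintype.piFinset_univ]
  -- The event `w = x ∧ y` factors over the coordinates, so the sum for fixed `w` becomes a product
  -- of one-bit sums.
  have hind : ∀ w x y : Fin n → Bool,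
      (∏ i, if w i = (x i && y i) then andDist (x i) (y i) else 0) =
        if w = bitAnd x y then ∏ i, andDist (x i) (y i) else 0 := by
    intro w x y
    rw [Finset.prod_ite_zero]
    simp [funext_iff, bitAnd]
  calc _ = ∑ x : Fin n → Bool, ∑ y : Fin n → Bool, ∑ w : Fin n → Bool,
        (∏ i, if w i = (x i && y i) then andDist (x i) (y i) else 0) * h w := by
        simp only [hind, ite_mul, zero_mul, Finset.sum_ite_eq',
          Finset.mem_univ, if_true]
    _ = ∑ w : Fin n → Bool, ∑ x : Fin n → Bool, ∑ y : Fin n → Bool,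
        (∏ i, if w i = (x i && y i) then andDist (x i) (y i) else 0) * h w := by
        rw [Finset.sum_comm]
        refine (Finset.sum_congr rfl fun y _ => Finset.sum_comm).trans ?_
        rw [Finset.sum_comm]
        exact Finset.sum_congr rfl fun w _ => Finset.sum_comm
    _ = ∑ w, (1 / 2 ^ n) * h w := by
        refine Finset.sum_congr rfl fun w _ => ?_
        simp only [← Finset.sum_mul]
        congr 1
        have h1 : ∀ x : Fin n → Bool,
            ∑ y : Fin n → Bool, ∏ i, (if w i = (x i && y i) then andDist (x i) (y i) else 0) =
              ∏ i, ∑ t, if w i = (x i && t) then andDist (x i) t else 0 :=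
          fun x => hpi fun i t => if w i = (x i && t) then andDist (x i) t else 0
        simp only [h1]
        rw [hpi fun i s => ∑ t, if w i = (s && t) then andDist s t else 0]
        have h2 : ∀ b : Bool, ∑ s, ∑ t, (if b = (s && t) then andDist s t else 0) = 1 / 2 := by
          intro b; cases b <;> norm_num [andDist]
        simp only [h2]
        simp
    _ = _ := by rw [Finset.mul_sum]

theorem fourierCoeff01_eq_sum_andDist {n : ℕ} (g : (Fin n → Bool) → Bool) (z : Fin n → Bool) :
    fourierCoeff01 g z = ∑ x, ∑ y, (∏ i, andDist (x i) (y i) * andSign (z i) (x i) (y i)) *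
      toReal01 g (bitAnd x y) := by
  have h := sum_andDist_bitAnd fun w => toReal01 g w * character z w
  rw [fourierCoeff01, cubeInner, ← h]
  refine Finset.sum_congr rfl fun x _ => Finset.sum_congr rfl fun y _ => ?_
  rw [character_bitAnd, Finset.prod_mul_distrib]
  ring

theorem abs_fourierCoeff01_le_one {n : ℕ} (g : (Fin n → Bool) → Bool) (z : Fin n → Bool) :
    |fourierCoeff01 g z| ≤ 1 := by
  rw [fourierCoeff01, cubeInner, abs_mul, abs_of_pos (by positivity : (0 : ℝ) < 1 / 2 ^ n)]
  have h : |∑ x, toReal01 g x * character z x| ≤ ∑ _x : Fin n → Bool, (1 : ℝ) := by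
    refine (Finset.abs_sum_le_sum_abs _ _).trans (Finset.sum_le_sum fun x _ => ?_)
    rw [abs_mul, character, abs_pow, abs_neg, abs_one, one_pow, mul_one, toReal01]
    split_ifs <;> simp
  have h2 : ∑ _x : Fin n → Bool, (1 : ℝ) = 2 ^ n := by simp
  rw [h2] at h
  calc _ ≤ (1 / 2 ^ n : ℝ) * 2 ^ n := by gcongr
    _ = 1 := by field_simp

theorem sum_andDist {n : ℕ} :
    ∑ x : Fin n → Bool, ∑ y : Fin n → Bool, ∏ i, andDist (x i) (y i) = 1 := by
  have h := sum_andDist_bitAnd (n := n) fun _ => 1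
  simpa using h

theorem sum_character_eq_zero {n : ℕ} {z : Fin n → Bool} {j : Fin n} (hj : z j = true) :
    ∑ x, character z x = 0 := by
  have h1 : ∀ x, character z x = ∏ i, if x i && z i then (-1 : ℝ) else 1 := by
    intro x
    rw [Finset.prod_ite, Finset.prod_const, Finset.prod_const_one, mul_one]
    rfl
  simp only [h1]
  have h2 := Finset.prod_univ_sum (fun _ : Fin n => (Finset.univ : Finset Bool))
    (fun i s => if s && z i then (-1 : ℝ) else 1)
  rw [Fintype.piFinset_univ] at h2
  rw [← h2]
  exact Finset.prod_eq_zero (Finset.mem_univ j) (by simp [hj])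

/-! ### Local transformations preserve the norm -/

section State

variable {Q : Type} [Fintype Q] [DecidableEq Q]

theorem sum_norm_sq_mulVec {ι : Type} [Fintype ι] [DecidableEq ι]
    (U : Matrix.unitaryGroup ι ℂ) (v : ι → ℂ) :
    ∑ i, ‖(U.1.mulVec v) i‖ ^ 2 = ∑ i, ‖v i‖ ^ 2 := by
  have hdot : ∀ w : ι → ℂ, ((∑ i, ‖w i‖ ^ 2 : ℝ) : ℂ) = star w ⬝ᵥ w := by
    intro w
    simp only [dotProduct, Complex.ofReal_sum, Complex.ofReal_pow, Pi.star_apply,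
      RCLike.star_def, Complex.conj_mul']
  apply Complex.ofReal_injective
  rw [hdot, hdot, Matrix.star_mulVec, Matrix.dotProduct_mulVec, Matrix.vecMul_vecMul,
    ← Matrix.star_eq_conjTranspose, Matrix.UnitaryGroup.star_mul_self, Matrix.vecMul_one]

theorem applyLocal_eq_mulVec (P : Q → Prop) [DecidablePred P]
    (U : Matrix ({q : Q // P q} → Bool) ({q : Q // P q} → Bool) ℂ) (ψ : QState Q) (s : Q → Bool) :
    applyLocal P U ψ s =
      U.mulVec (fun t => ψ fun q => if h : P q then t ⟨q, h⟩ else s q) (fun q => s q.1) := rfl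

/-- Once the labels of the untouched qubits are fixed, the action is multiplication by the unitary
matrix. -/
theorem sum_norm_sq_applyLocal (P : Q → Prop) [DecidablePred P]
    (U : Matrix.unitaryGroup ({q : Q // P q} → Bool) ℂ) (ψ : QState Q) :
    ∑ s, ‖applyLocal P U.1 ψ s‖ ^ 2 = ∑ s, ‖ψ s‖ ^ 2 := by
  let e := Equiv.piEquivPiSubtypeProd P fun _ : Q => Bool
  rw [← e.symm.sum_comp fun s => ‖ψ s‖ ^ 2, ← e.symm.sum_comp, Fintype.sum_prod_type_right,
    Fintype.sum_prod_type_right]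
  refine Finset.sum_congr rfl fun r _ => ?_
  rw [← sum_norm_sq_mulVec U fun t => ψ (e.symm (t, r))]
  refine Finset.sum_congr rfl fun t _ => ?_
  rw [applyLocal_eq_mulVec]
  congr 3
  · funext t'
    congr 1
    funext q
    by_cases h : P q <;> simp [e, Equiv.piEquivPiSubtypeProd, h]
  · funext q
    simp [e, Equiv.piEquivPiSubtypeProd, q.2]

theorem QProtocol.sum_norm_sq_finalState {own : Q → Player} (π : QProtocol Q own)
    (ψ : QState Q) : ∑ s, ‖π.finalState ψ s‖ ^ 2 = ∑ s, ‖ψ s‖ ^ 2 := by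
  induction π generalizing ψ with
  | measure q => rfl
  | round p U q hq rest ih =>
    rw [finalState, ih, sum_norm_sq_applyLocal]

theorem QProtocol.outputProb_nonneg {own : Q → Player} (π : QProtocol Q own) (ψ : QState Q)
    (b : Bool) : 0 ≤ π.outputProb ψ b :=
  Finset.sum_nonneg fun s _ => by split_ifs <;> positivity

theorem QProtocol.outputProb_true_add_false {own : Q → Player} (π : QProtocol Q own)
    (ψ : QState Q) : π.outputProb ψ true + π.outputProb ψ false = ∑ s, ‖ψ s‖ ^ 2 := by
  rw [← π.sum_norm_sq_finalState, outputProb, outputProb, ← Finset.sum_add_distrib]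
  refine Finset.sum_congr rfl fun s _ => ?_
  cases s π.outputQubit <;> simp

theorem sum_norm_sq_basisState (s : Q → Bool) : ∑ t, ‖basisState s t‖ ^ 2 = 1 := by
  rw [Finset.sum_eq_single s] <;> simp +contextual [basisState]

/-! ### Splitting states between the players -/

/-- The restriction of a basis label to the qubits of the player `p`. -/
def restrictTo (own : Q → Player) (p : Player) (s : Q → Bool) : {q : Q // own q = p} → Bool :=
  fun q => s q.1

/-- The states `ψ x y` are sums of products of a vector of Alice depending on `x` only and a
vector of Bob depending on `y` only, and the squared norms of the vectors of each player sum to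
at most `K`. -/
def IsSplit {X : Type} (K : ℝ) (own : Q → Player) (ψ : X → X → QState Q) : Prop :=
  ∃ (I : Type) (_ : Fintype I) (F : (p : Player) → I → X → ({q : Q // own q = p} → Bool) → ℂ),
    (∀ x y s, ψ x y s = ∑ i, F .alice i x (restrictTo own .alice s) *
      F .bob i y (restrictTo own .bob s)) ∧
    ∀ p x, ∑ i, ∑ r, ‖F p i x r‖ ^ 2 ≤ K

variable {X : Type} {K : ℝ} {own : Q → Player} {ψ : X → X → QState Q}

theorem Player.ne_iff_eq_other {p q : Player} : p ≠ q ↔ p = q.other := by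
  cases p <;> cases q <;> simp [Player.other]

theorem IsSplit.applyLocal (h : IsSplit K own ψ) (p : Player)
    (U : Matrix.unitaryGroup ({q : Q // own q = p} → Bool) ℂ) :
    IsSplit K own (fun x y => applyLocal (fun q => own q = p) U.1 (ψ x y)) := by
  obtain ⟨I, _, F, hF, hn⟩ := h
  refine ⟨I, inferInstance, Function.update F p fun i x => U.1.mulVec (F p i x), ?_, ?_⟩
  · intro x y s
    simp only [_root_.applyLocal, hF, Finset.mul_sum]
    rw [Finset.sum_comm]
    refine Finset.sum_congr rfl fun i _ => ?_
    cases p with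
    | alice =>
      rw [Function.update_self, Function.update_of_ne (by simp), Matrix.mulVec, dotProduct,
        Finset.sum_mul]
      refine Finset.sum_congr rfl fun t _ => ?_
      have h1 : restrictTo own .alice (fun q => if h : own q = .alice then t ⟨q, h⟩ else s q) = t := by
        funext q; simp [restrictTo, q.2]
      have h2 : restrictTo own .bob (fun q => if h : own q = .alice then t ⟨q, h⟩ else s q) =
          restrictTo own .bob s := by
        funext q; simp [restrictTo, q.2]
      rw [h1, h2, mul_assoc]
      rfl
    | bob =>
      rw [Function.update_self, Function.update_of_ne (by simp), Matrix.mulVec, dotProduct,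
        Finset.mul_sum]
      refine Finset.sum_congr rfl fun t _ => ?_
      have h1 : restrictTo own .bob (fun q => if h : own q = .bob then t ⟨q, h⟩ else s q) = t := by
        funext q; simp [restrictTo, q.2]
      have h2 : restrictTo own .alice (fun q => if h : own q = .bob then t ⟨q, h⟩ else s q) =
          restrictTo own .alice s := by
        funext q; simp [restrictTo, q.2]
      rw [h1, h2, mul_left_comm]
      rfl
  · intro p' x
    by_cases hp : p' = p
    · subst hp
      simpa only [Function.update_self, sum_norm_sq_mulVec] using hn p' x
    · simpa only [Function.update_of_ne hp] using hn p' x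

/-- The label of the qubits of `p` before `q₀` was handed over, from the label `r` of the qubits
of `p` afterwards and the value `c` of `q₀`. -/
def beforeTransfer (own : Q → Player) (q₀ : Q) (p' p : Player) (c : Bool)
    (r : {q : Q // Function.update own q₀ p' q = p} → Bool) : {q : Q // own q = p} → Bool :=
  fun q => if h : q.1 = q₀ then c else r ⟨q.1, by rw [Function.update_of_ne h]; exact q.2⟩

/-- If `p` possesses `q₀` after the transfer, then `r` assigns it the value `c`. -/
def TransferConsistent (own : Q → Player) (q₀ : Q) (p' p : Player) (c : Bool)
    (r : {q : Q // Function.update own q₀ p' q = p} → Bool) : Prop :=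
  ∀ h : Function.update own q₀ p' q₀ = p, r ⟨q₀, h⟩ = c

open scoped Classical in
-- Each product term is split according to the value `c` of the transferred qubit, which becomes
-- part of the index. The sender's slices keep their total norm, while the receiver's vector is
-- repeated for both values: this is the factor `2`.
theorem IsSplit.transfer (h : IsSplit K own ψ) (q₀ : Q) (p' : Player) :
    IsSplit (2 * K) (Function.update own q₀ p') ψ := by
  obtain ⟨I, _, F, hF, hn⟩ := h
  refine ⟨I × Bool, inferInstance, fun p i x r =>
    if TransferConsistent own q₀ p' p i.2 r then F p i.1 x (beforeTransfer own q₀ p' p i.2 r)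
    else 0, ?_, ?_⟩
  · intro x y s
    rw [hF, Fintype.sum_prod_type]
    refine Finset.sum_congr rfl fun i _ => ?_
    have hbefore : ∀ p, beforeTransfer own q₀ p' p (s q₀)
        (restrictTo (Function.update own q₀ p') p s) = restrictTo own p s := by
      intro p
      funext q
      by_cases hq : q.1 = q₀ <;> simp [beforeTransfer, restrictTo, hq]
    rw [Finset.sum_eq_single (s q₀)]
    · simp only [hbefore]
      have hcon : ∀ p, TransferConsistent own q₀ p' p (s q₀)
          (restrictTo (Function.update own q₀ p') p s) := fun p _ => rfl
      rw [if_pos (hcon _), if_pos (hcon _)]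
    · intro c _ hc
      have hnot : ∀ p, p' = p → ¬ TransferConsistent own q₀ p' p c
          -- Only the new owner sees `q₀`, and this player's factor alone kills the terms with the
          -- wrong `c`.
          (restrictTo (Function.update own q₀ p') p s) := fun p hp hcon =>
        hc (hcon (by rw [Function.update_self, hp])).symm
      dsimp only
      cases p' with
      | alice => rw [if_neg (hnot _ rfl), zero_mul]
      | bob => rw [if_neg (hnot .bob rfl), mul_zero]
    · simp
  · intro p x
    rw [Fintype.sum_prod_type]
    refine le_trans ?_ (mul_le_mul_of_nonneg_left (hn p x) zero_le_two)
    rw [Finset.mul_sum]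
    refine Finset.sum_le_sum fun i _ => ?_
    let B := {q : Q // own q = p} → Bool
    let A := {q : Q // Function.update own q₀ p' q = p} → Bool
    let φ : Bool × A → Bool × B := fun a => (a.1, beforeTransfer own q₀ p' p a.1 a.2)
    let S : Finset (Bool × A) :=
      Finset.univ.filter fun a => TransferConsistent own q₀ p' p a.1 a.2
    -- The only entry of `r` that the old label can miss is the one at `q₀`, and consistency forces
    -- it to be `c`.
    have hinj : Set.InjOn φ S := by
      rintro ⟨c, r⟩ hcr ⟨c', r'⟩ hcr' heq
      simp only [S, Finset.coe_filter, Finset.mem_univ, true_and, Set.mem_ofPred_eq] at hcr hcr'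
      simp only [φ, Prod.mk.injEq] at heq
      obtain ⟨rfl, heq⟩ := heq
      refine Prod.ext rfl (funext fun q => ?_)
      by_cases hq : q.1 = q₀
      · obtain ⟨q, hq'⟩ := q
        obtain rfl : q = q₀ := hq
        exact (hcr hq').trans (hcr' hq').symm
      · have := congrFun heq ⟨q.1, (Function.update_of_ne hq _ _).symm.trans q.2⟩
        simpa [beforeTransfer, hq] using this
    calc ∑ c : Bool, ∑ r : A, ‖(if TransferConsistent own q₀ p' p c r then
            F p i x (beforeTransfer own q₀ p' p c r) else 0)‖ ^ 2
        = ∑ a ∈ S, ‖F p i x (φ a).2‖ ^ 2 := by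
          rw [← Fintype.sum_prod_type', Finset.sum_filter]
          refine Finset.sum_congr rfl fun a _ => ?_
          split_ifs <;> simp [φ]
      _ = ∑ b ∈ S.image φ, ‖F p i x b.2‖ ^ 2 :=
          (Finset.sum_image (f := fun b : Bool × B => ‖F p i x b.2‖ ^ 2) hinj).symm
      _ ≤ ∑ b : Bool × B, ‖F p i x b.2‖ ^ 2 :=
          Finset.sum_le_univ_sum_of_nonneg fun b => by positivity
      _ = 2 * ∑ r, ‖F p i x r‖ ^ 2 := by
          rw [Fintype.sum_prod_type, Fintype.sum_bool, two_mul]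

theorem QProtocol.exists_isSplit_finalState (π : QProtocol Q own) (h : IsSplit K own ψ) :
    ∃ own', IsSplit (2 ^ π.cost * K) own' (fun x y => π.finalState (ψ x y)) := by
  induction π generalizing K ψ with
  | measure q => exact ⟨_, by simpa [cost, finalState] using h⟩
  | round p U q hq rest ih =>
    obtain ⟨own', h'⟩ := ih ((h.applyLocal p U).transfer q p.other)
    refine ⟨own', ?_⟩
    simpa only [cost, finalState, pow_succ, mul_assoc] using h'

/-- Basis labels of all qubits are pairs of basis labels for the qubits of the two players. -/
def splitEquiv (own : Q → Player) :
    (Q → Bool) ≃ ({q : Q // own q = .alice} → Bool) × ({q : Q // own q = .bob} → Bool) where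
  toFun s := (restrictTo own .alice s, restrictTo own .bob s)
  invFun t q := if h : own q = .alice then t.1 ⟨q, h⟩
    else t.2 ⟨q, Player.ne_iff_eq_other.1 h⟩
  left_inv s := by
    funext q
    by_cases h : own q = .alice <;> simp [restrictTo, h]
  right_inv t := by
    refine Prod.ext (funext fun q => ?_) (funext fun q => ?_) <;> simp [restrictTo, q.2]

theorem sum_restrictTo_mul (own : Q → Player) (G : ({q : Q // own q = .alice} → Bool) → ℂ)
    (H : ({q : Q // own q = .bob} → Bool) → ℂ) :
    ∑ s, G (restrictTo own .alice s) * H (restrictTo own .bob s) = (∑ r, G r) * ∑ r, H r := by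
  rw [Finset.sum_mul_sum, ← Fintype.sum_prod_type']
  exact (splitEquiv own).sum_comp fun t => G t.1 * H t.2

open scoped Classical in
-- Expanding `|ψ|²` over pairs of indices and summing over labels separates the players. The new
-- vectors consist of inner products of the old ones, so Cauchy–Schwarz squares the constant.
theorem IsSplit.hasFactorization (h : IsSplit K own ψ) (q : Q) (b : Bool) :
    HasFactorization (K ^ 2)
      (fun x y => ((∑ s, if s q = b then ‖ψ x y s‖ ^ 2 else 0 : ℝ) : ℂ)) := by
  obtain ⟨I, _, F, hF, hn⟩ := h
  -- The measured qubit constrains only its owner's label; for the other player the condition is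
  -- vacuous.
  let good : (p : Player) → ({q : Q // own q = p} → Bool) → ℂ := fun p r =>
    if ∀ h : own q = p, r ⟨q, h⟩ = b then 1 else 0
  let u : (p : Player) → I × I → X → ℂ := fun p i x =>
    ∑ r, good p r * (F p i.1 x r * star (F p i.2 x r))
  have hu : ∀ p x, ∑ i, ‖u p i x‖ ^ 2 ≤ K ^ 2 := by
    intro p x
    have h1 : ∀ i : I × I, ‖u p i x‖ ^ 2 ≤ (∑ r, ‖F p i.1 x r‖ ^ 2) * ∑ r, ‖F p i.2 x r‖ ^ 2 := by
      intro i
      have h2 : ‖u p i x‖ ≤ ∑ r, ‖F p i.1 x r‖ * ‖F p i.2 x r‖ := by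
        refine (norm_sum_le _ _).trans (Finset.sum_le_sum fun r _ => ?_)
        rw [norm_mul, norm_mul, norm_star]
        have h3 : ‖good p r‖ ≤ 1 := by
          simp only [good]; split_ifs <;> simp
        exact mul_le_of_le_one_left (by positivity) h3
      exact (pow_le_pow_left₀ (norm_nonneg _) h2 2).trans (Finset.sum_mul_sq_le_sq_mul_sq _ _ _)
    calc ∑ i, ‖u p i x‖ ^ 2
        ≤ ∑ i : I × I, (∑ r, ‖F p i.1 x r‖ ^ 2) * ∑ r, ‖F p i.2 x r‖ ^ 2 :=
          Finset.sum_le_sum fun i _ => h1 i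
      _ = (∑ i, ∑ r, ‖F p i x r‖ ^ 2) ^ 2 := by
          rw [sq, Finset.sum_mul_sum, Fintype.sum_prod_type]
      _ ≤ K ^ 2 := pow_le_pow_left₀ (by positivity) (hn p x) 2
  refine ⟨I × I, inferInstance, u .alice, u .bob, ?_, hu _, hu _⟩
  intro x y
  have hgood : ∀ s : Q → Bool, (if s q = b then (1 : ℂ) else 0) =
      good .alice (restrictTo own .alice s) * good .bob (restrictTo own .bob s) := by
    intro s
    simp only [good, restrictTo]
    have hown : own q = .alice ∨ own q = .bob := by rcases own q <;> simp
    rcases hown with h | h <;> simp [h]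
  have hterm : ∀ s : Q → Bool, ((if s q = b then ‖ψ x y s‖ ^ 2 else 0 : ℝ) : ℂ) =
      ∑ i : I × I,
        (good .alice (restrictTo own .alice s) * (F .alice i.1 x (restrictTo own .alice s) *
          star (F .alice i.2 x (restrictTo own .alice s)))) *
        (good .bob (restrictTo own .bob s) * (F .bob i.1 y (restrictTo own .bob s) *
          star (F .bob i.2 y (restrictTo own .bob s)))) := by
    intro s
    have h1 : ((if s q = b then ‖ψ x y s‖ ^ 2 else 0 : ℝ) : ℂ) =
        (if s q = b then (1 : ℂ) else 0) * (ψ x y s * star (ψ x y s)) := by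
      split_ifs
      · rw [one_mul, RCLike.star_def, Complex.mul_conj', Complex.ofReal_pow]
      · simp
    rw [h1, hgood, hF, star_sum, Finset.sum_mul_sum, ← Fintype.sum_prod_type', Finset.mul_sum]
    refine Finset.sum_congr rfl fun i _ => ?_
    rw [star_mul']
    ring
  simp only [Complex.ofReal_sum, hterm]
  rw [Finset.sum_comm]
  exact Finset.sum_congr rfl fun i _ => sum_restrictTo_mul own
    (fun r => good .alice r * (F .alice i.1 x r * star (F .alice i.2 x r)))
    (fun r => good .bob r * (F .bob i.1 y r * star (F .bob i.2 y r)))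

end State

theorem isSplit_initialState (n a b : ℕ) :
    IsSplit 1 (initialOwner n a b) (fun x y : Fin n → Bool => initialState a b x y) := by
  let start : (Fin n → Bool) → Qubits n a b → Bool := fun x =>
    Sum.elim (Sum.elim x fun _ => false) (Sum.elim x fun _ => false)
  refine ⟨Unit, inferInstance,
    fun p _ x r => if r = restrictTo _ p (start x) then 1 else 0, ?_, ?_⟩
  · intro x y s
    have h : (s = Sum.elim (Sum.elim x fun _ => false) (Sum.elim y fun _ => false)) ↔
        restrictTo (initialOwner n a b) .alice s = restrictTo _ .alice (start x) ∧
        restrictTo (initialOwner n a b) .bob s = restrictTo _ .bob (start y) := by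
      simp [funext_iff, restrictTo, start, initialOwner]
    simp only [initialState, basisState, h, Finset.univ_unique, Finset.sum_singleton]
    split_ifs <;> simp_all
  · intro p x
    simp only [Finset.univ_unique, Finset.sum_singleton]
    rw [Finset.sum_eq_single (restrictTo _ p (start x))] <;> simp +contextual

theorem QProtocol.hasFactorization_outputProb {n a b : ℕ}
    (π : QProtocol (Qubits n a b) (initialOwner n a b)) (c : Bool) :
    HasFactorization (4 ^ π.cost)
      (fun x y : Fin n → Bool => (π.outputProb (initialState a b x y) c : ℂ)) := by
  obtain ⟨own', h⟩ := π.exists_isSplit_finalState (isSplit_initialState n a b)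
  have h' := h.hasFactorization π.outputQubit c
  have hK : ((2 : ℝ) ^ π.cost * 1) ^ 2 = 4 ^ π.cost := by
    rw [mul_one, ← pow_mul, mul_comm, pow_mul]; norm_num
  rw [hK] at h'
  exact h'

/-! ### The lower bound -/

theorem outputProb_measure_initialState {n a b : ℕ} (q : Qubits n a b) (x y : Fin n → Bool)
    (c : Bool) :
    (QProtocol.measure (own := initialOwner n a b) q).outputProb (initialState a b x y) c =
      if Sum.elim (Sum.elim x fun _ => false) (Sum.elim y fun _ => false) q = c then 1 else 0 := by
  simp only [QProtocol.outputProb, QProtocol.outputQubit, QProtocol.finalState, initialState]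
  rw [Finset.sum_eq_single (Sum.elim (Sum.elim x fun _ => false) (Sum.elim y fun _ => false))]
  · simp [basisState]
  · intro s _ hs
    simp [basisState, hs]
  · simp

/-- Without communication the measured qubit is a fixed classical bit depending on one input only.
Putting the all-ones string on that side lets the other input run through all conjunctions. -/
theorem const_of_computesWithError_of_cost_eq_zero {n a b : ℕ}
    {π : QProtocol (Qubits n a b) (initialOwner n a b)} {g : (Fin n → Bool) → Bool}
    (hπ : ComputesWithError π (fun x y => g (bitAnd x y)) (1 / 3)) (hcost : π.cost = 0)
    (w : Fin n → Bool) : g w = g fun _ => false := by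
  cases π with
  | round p U q hq rest => simp [QProtocol.cost] at hcost
  | measure q =>
    have h : ∀ x y : Fin n → Bool,
        Sum.elim (Sum.elim x fun _ => false) (Sum.elim y fun _ => false) q = g (bitAnd x y) := by
      intro x y
      have hxy := hπ x y
      rw [outputProb_measure_initialState] at hxy
      by_contra hne
      rw [if_neg hne] at hxy
      norm_num at hxy
    have hl : ∀ y : Fin n → Bool, bitAnd (fun _ => true) y = y := fun y => by
      funext i; simp [bitAnd]
    have hr : ∀ x : Fin n → Bool, bitAnd x (fun _ => true) = x := fun x => by
      funext i; simp [bitAnd]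
    cases q with
    | inl q =>
      rw [← hl w, ← hl fun _ => false, ← h, ← h]
      rfl
    | inr q =>
      rw [← hr w, ← hr fun _ => false, ← h, ← h]
      rfl

/-- A constant `g` has no nonzero coefficient at `z ≠ 0`. Having cost at least `1` lets additive
terms later be absorbed into multiples of the cost. -/
theorem one_le_cost_of_fourierCoeff01_ne_zero {n a b : ℕ}
    {π : QProtocol (Qubits n a b) (initialOwner n a b)} {g : (Fin n → Bool) → Bool}
    (hπ : ComputesWithError π (fun x y => g (bitAnd x y)) (1 / 3)) {z : Fin n → Bool}
    {j : Fin n} (hj : z j = true) (hz : fourierCoeff01 g z ≠ 0) : 1 ≤ π.cost := by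
  by_contra! hcost
  refine hz ?_
  have hg := const_of_computesWithError_of_cost_eq_zero hπ (by omega)
  have h : ∀ x, toReal01 g x * character z x =
      toReal01 g (fun _ => false) * character z x := fun x => by simp only [toReal01, hg x]
  simp only [fourierCoeff01, cubeInner, h, ← Finset.mul_sum, sum_character_eq_zero hj, mul_zero]

theorem abs_fourierCoeff01_le {n a b : ℕ} {π : QProtocol (Qubits n a b) (initialOwner n a b)}
    {g : (Fin n → Bool) → Bool}
    (hπ : ComputesWithError π (fun x y => g (bitAnd x y)) (1 / 3)) (z : Fin n → Bool) (m : ℕ) :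
    |fourierCoeff01 g z| ≤
      (17 / 20) ^ hammingWeight z * (4 * (4 ^ π.cost) ^ 2) ^ m + (8 / 9) ^ m := by
  let p : Bool → (Fin n → Bool) → (Fin n → Bool) → ℝ := fun c x y =>
    π.outputProb (initialState a b x y) c
  have hp : ∀ c x y, 0 ≤ p c x y := fun c x y => π.outputProb_nonneg _ _
  have hp1 : ∀ x y, p true x y + p false x y = 1 := fun x y => by
    rw [π.outputProb_true_add_false, initialState, sum_norm_sq_basisState]
  let W : (Fin n → Bool) → (Fin n → Bool) → ℝ := fun x y =>
    ∏ i, andDist (x i) (y i) * andSign (z i) (x i) (y i)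
  have hW : ∀ x y, |W x y| = ∏ i, andDist (x i) (y i) := by
    intro x y
    simp only [W]
    rw [Finset.abs_prod]
    refine Finset.prod_congr rfl fun i _ => ?_
    rw [abs_mul]
    have h1 : |andDist (x i) (y i)| = andDist (x i) (y i) :=
      abs_of_nonneg (by rw [andDist]; split_ifs <;> norm_num)
    have h2 : |andSign (z i) (x i) (y i)| = 1 := by rw [andSign]; split_ifs <;> simp
    rw [h1, h2, mul_one]
  have herr : ∀ x y, |toReal01 g (bitAnd x y) - majorityPoly m (p true x y) (p false x y)| ≤
      (8 / 9) ^ m := by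
    intro x y
    have hxy := hπ x y
    dsimp only at hxy
    cases hg : g (bitAnd x y) with
    | true =>
      rw [hg] at hxy
      change 1 - 1 / 3 ≤ p true x y at hxy
      have h := one_sub_majorityPoly_mem m (hp false x y) (hp1 x y) (by linarith [hp1 x y])
      rw [toReal01, if_pos hg, abs_of_nonneg h.1]
      exact h.2
    | false =>
      rw [hg] at hxy
      change 1 - 1 / 3 ≤ p false x y at hxy
      have h := majorityPoly_le_of_le_third m (hp true x y) (hp1 x y) (by linarith [hp1 x y])
      rw [toReal01, hg, if_neg (by simp), zero_sub, abs_neg,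
        abs_of_nonneg (majorityPoly_nonneg m (hp _ x y) (hp _ x y))]
      exact h
  have hmain : |∑ x, ∑ y, W x y * majorityPoly m (p true x y) (p false x y)| ≤
      (17 / 20) ^ hammingWeight z * (4 * (4 ^ π.cost) ^ 2) ^ m := by
    have h := norm_sum_mul_le_of_hasFactorization z
      ((π.hasFactorization_outputProb true).majorityPoly (π.hasFactorization_outputProb false)
        (by positivity) m)
    rw [← Real.norm_eq_abs, ← Complex.norm_real]
    convert h using 2
    simp [W, p, majorityPoly]
  have hdiff : |∑ x, ∑ y, W x y *
      (toReal01 g (bitAnd x y) - majorityPoly m (p true x y) (p false x y))| ≤ (8 / 9) ^ m := by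
    calc _ ≤ ∑ x : Fin n → Bool, ∑ y : Fin n → Bool, (∏ i, andDist (x i) (y i)) * (8 / 9 : ℝ) ^ m := by
          refine (Finset.abs_sum_le_sum_abs _ _).trans (Finset.sum_le_sum fun x _ =>
            (Finset.abs_sum_le_sum_abs _ _).trans (Finset.sum_le_sum fun y _ => ?_))
          rw [abs_mul, ← hW]
          exact mul_le_mul_of_nonneg_left (herr x y) (abs_nonneg _)
      _ = (8 / 9) ^ m := by
          simp only [← Finset.sum_mul]
          rw [sum_andDist, one_mul]
  have hsplit : fourierCoeff01 g z =
      ∑ x, ∑ y, W x y * majorityPoly m (p true x y) (p false x y) + ∑ x, ∑ y, W x y *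
        (toReal01 g (bitAnd x y) - majorityPoly m (p true x y) (p false x y)) := by
    rw [fourierCoeff01_eq_sum_andDist, ← Finset.sum_add_distrib]
    refine Finset.sum_congr rfl fun x _ => ?_
    rw [← Finset.sum_add_distrib]
    exact Finset.sum_congr rfl fun y _ => by ring
  rw [hsplit]
  exact (abs_add_le _ _).trans (add_le_add hmain hdiff)

theorem hammingWeight_le_mul_cost {n a b : ℕ}
    {π : QProtocol (Qubits n a b) (initialOwner n a b)} {g : (Fin n → Bool) → Bool}
    (hπ : ComputesWithError π (fun x y => g (bitAnd x y)) (1 / 3)) {z : Fin n → Bool} {l : ℕ}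
    (hl : 2 * (1 / 2 : ℝ) ^ l ≤ |fourierCoeff01 g z|) (hz : fourierCoeff01 g z ≠ 0) :
    hammingWeight z ≤ 185 * (π.cost * l) := by
  rcases Nat.eq_zero_or_pos (hammingWeight z) with h0 | hpos
  · omega
  obtain ⟨j, hj⟩ := Finset.card_pos.1 hpos
  have hcost : 1 ≤ π.cost := one_le_cost_of_fourierCoeff01_ne_zero hπ (Finset.mem_filter.1 hj).2 hz
  have h := hl.trans (abs_fourierCoeff01_le hπ z (6 * l))
  set k := hammingWeight z
  set c := π.cost
  -- The choice `m = 6 * l` comes from `(8/9) ^ 6 < 1/2`.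
  have h1 : ((8 : ℝ) / 9) ^ (6 * l) ≤ (1 / 2) ^ l := by
    rw [pow_mul]
    exact pow_le_pow_left₀ (by positivity) (by norm_num) l
  -- The exponent is `6 * l * (2 + 4 * c)`, at most `36 * (c * l)` because `c ≥ 1`.
  have h2 : (4 * ((4 : ℝ) ^ c) ^ 2) ^ (6 * l) ≤ 2 ^ (36 * (c * l)) := by
    have : (4 * ((4 : ℝ) ^ c) ^ 2) = 2 ^ (2 + 4 * c) := by
      rw [pow_add, pow_mul, ← pow_mul, mul_comm c 2, pow_mul]; norm_num
    rw [this, ← pow_mul]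
    exact pow_le_pow_right₀ (by norm_num) (by nlinarith)
  have hl' : l ≤ c * l := Nat.le_mul_of_pos_left l hcost
  have h3 : (1 : ℝ) ≤ (17 / 20) ^ k * 2 ^ (37 * (c * l)) := by
    have h4 : ((1 : ℝ) / 2) ^ l ≤ (17 / 20) ^ k * 2 ^ (36 * (c * l)) := by
      have := mul_le_mul_of_nonneg_left h2 (by positivity : (0 : ℝ) ≤ (17 / 20) ^ k)
      linarith
    calc (1 : ℝ) = (1 / 2) ^ l * 2 ^ l := by rw [← mul_pow]; norm_num
      _ ≤ (17 / 20) ^ k * 2 ^ (36 * (c * l)) * 2 ^ (c * l) := by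
          gcongr
          norm_num
      _ = _ := by rw [mul_assoc, ← pow_add]; ring_nf
  -- Fifth powers suffice since `2 * (17/20) ^ 5 < 1`; this gives `185 = 5 * 37`.
  have h5 : (2 : ℝ) ^ k ≤ 2 ^ (185 * (c * l)) := by
    calc (2 : ℝ) ^ k ≤ 2 ^ k * ((17 / 20) ^ k * 2 ^ (37 * (c * l))) ^ 5 :=
          le_mul_of_one_le_right (by positivity) (one_le_pow₀ h3)
      _ = (2 * (17 / 20) ^ 5) ^ k * 2 ^ (185 * (c * l)) := by
          rw [mul_pow, mul_pow, ← pow_mul, ← pow_mul, ← pow_mul, mul_comm k 5, ← mul_assoc]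
          congr 2
          ring
      _ ≤ 1 * 2 ^ (185 * (c * l)) := by
          gcongr
          exact pow_le_one₀ (by positivity) (by norm_num)
      _ = _ := one_mul _
  exact (pow_le_pow_iff_right₀ (by norm_num)).1 h5

theorem theorem6p1 :
    ∃ c : ℝ, 0 < c ∧
      ∀ (n : ℕ) (g : (Fin n → Bool) → Bool) (f : (Fin n → Bool) → (Fin n → Bool) → Bool),
        (∀ x y, f x y = g (bitAnd x y)) →
        ∀ z : Fin n → Bool, fourierCoeff01 g z ≠ 0 →
          ENNReal.ofReal
              (c * ((hammingWeight z : ℝ) / (1 - Real.logb 2 |fourierCoeff01 g z|))) ≤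
            ((BQC f : ℕ∞) : ℝ≥0∞) := by
  -- `370 = 2 * 185`; the `2` pays for rounding `L ≥ 1` up to an integer.
  refine ⟨1 / 370, by norm_num, fun n g f hf z hz => ?_⟩
  obtain rfl : f = fun x y => g (bitAnd x y) := funext fun x => funext fun y => hf x y
  have hpos : 0 < |fourierCoeff01 g z| := abs_pos.2 hz
  set L : ℝ := 1 - Real.logb 2 |fourierCoeff01 g z| with hL
  have hL1 : 1 ≤ L := by
    have := Real.logb_nonpos (b := 2) (by norm_num) hpos.le (abs_fourierCoeff01_le_one g z)
    linarith
  set l := ⌈L⌉₊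
  have hlL : (l : ℝ) ≤ 2 * L := by
    have := Nat.ceil_lt_add_one (show 0 ≤ L by linarith)
    linarith
  have hl : 2 * (1 / 2 : ℝ) ^ l ≤ |fourierCoeff01 g z| := by
    have h1 : |fourierCoeff01 g z| = 2 * (2 : ℝ) ^ (-L) := by
      rw [hL, neg_sub, Real.rpow_sub (by norm_num), Real.rpow_one,
        Real.rpow_logb (by norm_num) (by norm_num) hpos]
      ring
    rw [h1, one_div, inv_pow, ← Real.rpow_natCast, ← Real.rpow_neg (by norm_num)]
    gcongr
    · norm_num
    · exact Nat.le_ceil L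
  -- Costs are natural numbers, so the real bound passes to its ceiling and the infimum can be
  -- handled in `ℕ∞`.
  have key : (⌈1 / 370 * ((hammingWeight z : ℝ) / L)⌉₊ : ℕ∞) ≤
      BQC fun x y => g (bitAnd x y) := by
    refine le_iInf fun a => le_iInf fun b => le_iInf fun π => le_iInf fun hπ => ?_
    rw [Nat.cast_le, Nat.ceil_le, ← mul_div_assoc, div_le_iff₀ (by linarith)]
    have h : (hammingWeight z : ℝ) ≤ 185 * (π.cost * l) := by
      exact_mod_cast hammingWeight_le_mul_cost hπ hl hz
    have h2 : (π.cost : ℝ) * l ≤ π.cost * (2 * L) := by gcongr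
    linarith
  calc _ ≤ ((⌈1 / 370 * ((hammingWeight z : ℝ) / L)⌉₊ : ℕ) : ℝ≥0∞) := by
        rw [← ENNReal.ofReal_natCast]
        exact ENNReal.ofReal_le_ofReal (Nat.le_ceil _)
    _ ≤ _ := by
        rw [← ENat.toENNReal_coe]
        exact ENat.toENNReal_le.2 key
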